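/- Consider a two-layer network with one server holding $N\ge 1$ independent files $W_1,\dots,W_N$, each uniformly distributed on $[2^F]$, with $K_1\ge 1$ relays, and with $K_2\ge 1$ users attached to each relay. Every relay has a cache with $\lfloor 2^{FM_1}\rfloor$ possible contents and every user a cache with $\lfloor 2^{FM_2}\rfloor$ possible contents, $M_1,M_2\in[0,N]$. The caches are filled as functions of $(W_1,\dots,W_N)$ before the requests are known. Then every user requests one file, and the request vector $\mathbf d\in[N]^{K_1K_2}$ becomes known to all nodes. Transmission proceeds in $T_c(\mathbf d)$ slots. In each slot the server sends one bit, a function of the library, over a noiseless link shared by all relays, and concurrently each relay sends one bit, a function of its cache content and of the server's bits of the earlier slots, over a noiseless link shared by its $K_2$ users. At the end each user estimates its requested file from the bits of its relay and its own cache content. A delay $T$ is achievable if for every $\epsilon>0$ and every large enough $F$ there is such a scheme with $T_c(\mathbf d)/F\le T$ for all $\mathbf d$ and with probability of error less than $\epsilon$ for every $\mathbf d$ and every user. The optimal coding delay $T^*$ is the infimum of the achievable delays. For an integer $K\ge 0$ and $q\in[0,1]$ let $$r(q,K)\triangleq\Big[\frac{1-q}{q}\big(1-(1-q)^K\big)\Big]^+\quad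 (q>0),\qquad r(0,K)\triangleq K .$$ Theorem. For all $M_1,M_2\in[0,N]$ and $\alpha,\beta\in[0,1]$, $$T^*\le T_{\mathrm{propose}}=R'+R'',$$ where, with $\mu_1\triangleq\min\{\tfrac{M_1}{\alpha N},1\}$, $\mu_2\triangleq\min\{\tfrac{\beta M_2}{\alpha N},1\}$ and $\mu_3\triangleq\min\{\tfrac{(1-\beta)M_2}{(1-\alpha)N},1\}$, $$R_{s_1}=\alpha\big[r(\mu_1,K_1)-K_1(1-\mu_1)^{K_1}\big]\,r(\mu_2,K_2),\qquad R_{s_2}=\alpha(1-\mu_1)^{K_1}\,r(\mu_2,K_1K_2),$$ $$R_{s_3}=\alpha\,\mu_1\,r(\mu_2,K_2),\qquad R_e=\alpha(1-\mu_1)^{K_1}(1-\mu_2)^{K_2}\,r(\mu_2,(K_1-1)K_2),$$ $$R'=R_{s_1}+R_{s_2}+\max\{R_{s_3}-R_e,0\},\qquad R''=(1-\alpha)\,r(\mu_3,K_1K_2).$$ Here $R'=0$ for $\alpha=0$ and $R''=0$ for $\alpha=1$. -/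

import Mathlib

/-- A realization of the library: `N` files, each one of `2 ^ F` values (`F` bits). -/
abbrev Library (N F : ℕ) : Type := Fin N → Fin (2 ^ F)

/-- A request vector: `d i j` is the file requested by the `j`-th user attached to relay `i`. -/
abbrev Demand (N K₁ K₂ : ℕ) : Type := Fin K₁ → Fin K₂ → Fin N

/-- Number of possible contents of a cache memory of `M * F` bits. -/
noncomputable def cacheSize (F : ℕ) (M : ℝ) : ℕ := ⌊(2 : ℝ) ^ ((F : ℝ) * M)⌋₊

/-- A caching scheme for the two-layer network with file size `F` bits. Time is slotted. In each
slot the server sends one bit on its link to all the relays and, concurrently, every relay sends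
one bit on its link to all its users. -/
structure CachingScheme (N K₁ K₂ F : ℕ) (M₁ M₂ : ℝ) where
  /-- caching functions of the relays -/
  relayCache : Fin K₁ → Library N F → Fin (cacheSize F M₁)
  /-- caching functions of the users -/
  userCache : Fin K₁ → Fin K₂ → Library N F → Fin (cacheSize F M₂)
  /-- number of transmission slots used for a request vector -/
  slots : Demand N K₁ K₂ → ℕ
  /-- bit sent by the server in slot `t` -/
  serverEnc : (d : Demand N K₁ K₂) → Fin (slots d) → Library N F → Bool
  /-- bit sent by relay `i` in slot `t`: a function of its cache content and of the bits that
  the server has sent in the slots before `t` -/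
  relayEnc : Fin K₁ → (d : Demand N K₁ K₂) → (t : Fin (slots d)) →
    Fin (cacheSize F M₁) → (Fin (t : ℕ) → Bool) → Bool
  /-- decoding functions of the users -/
  decode : Fin K₁ → Fin K₂ → (d : Demand N K₁ K₂) →
    (Fin (slots d) → Bool) → Fin (cacheSize F M₂) → Fin (2 ^ F)

namespace CachingScheme

/-- The sequence of bits that relay `i` sends to its users. -/
def relaySignal {N K₁ K₂ F : ℕ} {M₁ M₂ : ℝ} (c : CachingScheme N K₁ K₂ F M₁ M₂)
    (d : Demand N K₁ K₂) (i : Fin K₁) (w : Library N F) : Fin (c.slots d) → Bool :=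
  fun t => c.relayEnc i d t (c.relayCache i w)
    (fun s => c.serverEnc d ⟨(s : ℕ), s.isLt.trans t.isLt⟩ w)

/-- The estimate of the requested file that the `j`-th user of relay `i` forms. -/
def estimate {N K₁ K₂ F : ℕ} {M₁ M₂ : ℝ} (c : CachingScheme N K₁ K₂ F M₁ M₂)
    (d : Demand N K₁ K₂) (i : Fin K₁) (j : Fin K₂) (w : Library N F) : Fin (2 ^ F) :=
  c.decode i j d (c.relaySignal d i w) (c.userCache i j w)

/-- Probability, over independent files that are uniform on the `2 ^ F` values, that the `j`-th
user of relay `i` does not recover the file it requests. -/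
noncomputable def errorProb {N K₁ K₂ F : ℕ} {M₁ M₂ : ℝ} (c : CachingScheme N K₁ K₂ F M₁ M₂)
    (d : Demand N K₁ K₂) (i : Fin K₁) (j : Fin K₂) : ℝ :=
  ((Finset.univ.filter (fun w : Library N F => c.estimate d i j w ≠ w (d i j))).card : ℝ) /
    (Fintype.card (Library N F) : ℝ)

/-- The coding delay for the request vector `d`: number of slots normalized by the file size. -/
noncomputable def delay {N K₁ K₂ F : ℕ} {M₁ M₂ : ℝ} (c : CachingScheme N K₁ K₂ F M₁ M₂)
    (d : Demand N K₁ K₂) : ℝ := (c.slots d : ℝ) / (F : ℝ)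

end CachingScheme

/-- The delay `T` is achievable: for every `ε > 0` and every large enough file size there is a
scheme with worst-case error probability below `ε` and coding delay at most `T` for all
request vectors. -/
def DelayAchievable (N K₁ K₂ : ℕ) (M₁ M₂ T : ℝ) : Prop :=
  ∀ ε : ℝ, 0 < ε → ∃ F₀ : ℕ, ∀ F : ℕ, F₀ ≤ F →
    ∃ c : CachingScheme N K₁ K₂ F M₁ M₂,
      (∀ d i j, c.errorProb d i j < ε) ∧ ∀ d, c.delay d ≤ T

/-- The optimal coding delay `T*`. The infimum is taken in the extended reals, so that it would
be `⊤` if no delay were achievable. -/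
noncomputable def optimalDelay (N K₁ K₂ : ℕ) (M₁ M₂ : ℝ) : EReal :=
  sInf ((fun T : ℝ => (T : EReal)) '' {T : ℝ | DelayAchievable N K₁ K₂ M₁ M₂ T})

/-- The delay `r(q, K)` of decentralized coded caching in the single-layer network with `K` users
that each cache a fraction `q` of the library; its value at `q = 0` is the limit `K`. -/
noncomputable def rateDec (q : ℝ) (K : ℕ) : ℝ :=
  if q = 0 then (K : ℝ)
  else max ((K : ℝ) * (1 - q) * (1 / ((K : ℝ) * q)) * (1 - (1 - q) ^ K)) 0

/-- The fraction of a library of size `n` files that fits into a cache of size `m` files. -/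
noncomputable def cacheFraction (m n : ℝ) : ℝ := min (m / n) 1

noncomputable def rateS1 (N K₁ K₂ : ℕ) (M₁ M₂ α β : ℝ) : ℝ :=
  α * (rateDec (cacheFraction M₁ (α * N)) K₁
      - (K₁ : ℝ) * (1 - cacheFraction M₁ (α * N)) ^ K₁)
    * rateDec (cacheFraction (β * M₂) (α * N)) K₂

noncomputable def rateS2 (N K₁ K₂ : ℕ) (M₁ M₂ α β : ℝ) : ℝ :=
  α * (1 - cacheFraction M₁ (α * N)) ^ K₁
    * rateDec (cacheFraction (β * M₂) (α * N)) (K₁ * K₂)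

noncomputable def rateS3 (N K₂ : ℕ) (M₁ M₂ α β : ℝ) : ℝ :=
  α * cacheFraction M₁ (α * N) * rateDec (cacheFraction (β * M₂) (α * N)) K₂

noncomputable def rateE (N K₁ K₂ : ℕ) (M₁ M₂ α β : ℝ) : ℝ :=
  α * (1 - cacheFraction M₁ (α * N)) ^ K₁
    * (1 - cacheFraction (β * M₂) (α * N)) ^ K₂
    * rateDec (cacheFraction (β * M₂) (α * N)) ((K₁ - 1) * K₂)

/-- The delay `R'` of the concurrent scheme on the first subsystem. -/
noncomputable def rateConcurrent (N K₁ K₂ : ℕ) (M₁ M₂ α β : ℝ) : ℝ :=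
  rateS1 N K₁ K₂ M₁ M₂ α β + rateS2 N K₁ K₂ M₁ M₂ α β
    + max (rateS3 N K₂ M₁ M₂ α β - rateE N K₁ K₂ M₁ M₂ α β) 0

/-- The delay `R''` of pipeline forwarding on the second subsystem. -/
noncomputable def ratePipeline (N K₁ K₂ : ℕ) (M₂ α β : ℝ) : ℝ :=
  (1 - α) * rateDec (cacheFraction ((1 - β) * M₂) ((1 - α) * N)) (K₁ * K₂)

/-- The delay `T_propose = R' + R''`. -/
noncomputable def delayPropose (N K₁ K₂ : ℕ) (M₁ M₂ α β : ℝ) : ℝ :=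
  rateConcurrent N K₁ K₂ M₁ M₂ α β + ratePipeline N K₁ K₂ M₂ α β

/-!
The delay is attained, up to an arbitrarily small excess, by a deterministic scheme without errors.
Every file is cut in the same way into pieces indexed by the set of nodes that cache them, and the
sizes of the pieces are the expected sizes under decentralized random placement, rounded down. The
bounded remainder is cached by nobody. Pieces that no relay caches are indexed by sets of
users of the whole network, the others by a set of relays and a set of user numbers common to all
relays. The second subsystem is just another contribution to the pieces that no relay caches.

For a set `A` of users the server superimposes, over the users in `A`, the bits that this user
wants and all the others in `A` cache (`userCode`). For pieces cached by relays the same coding is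
used twice: relay `i` superimposes over its users (`relayCode`), and the server superimposes
over a set `Q` of relays the messages that relay `i ∈ Q` needs and the others in `Q` can compute.
A relay thus extracts each of its messages from its cache and at most one server message
(`relayValue_eq`), and its messages suffice for its users (`eq_of_relayValue_eq`).

By `exists_scheme_of_messages`, server and relays can work concurrently, a relay sending a message
one slot after the server message that it depends on and using its idle slots for the messages that
it computes from its cache alone. Hence the delay is the maximum of the number of server messages
and the numbers of messages of the relays, plus one slot. The server has load
`R_{s₁} + R_{s₂} + R''`, and a relay at most `R_{s₁} + R_{s₂} + R'' + R_{s₃} - R_e`, since it need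
not forward the messages for users of other relays only; the maximum is at most `R' + R''`. These
loads are sums of binomial weights, and `sum_powerset_binWeight_pred` identifies them with
`rateDec`.
-/

/-! ### Schemes from messages -/

/-- Two libraries have the same bits at the positions in `s`, in every file. -/
def AgreeOn {N : ℕ} {P : Type} (s : Finset P) (w w' : Fin N → P → ZMod 2) : Prop :=
  ∀ f, ∀ p ∈ s, w f p = w' f p

theorem two_pow_le_cacheSize {F m : ℕ} {M : ℝ} (h : (m : ℝ) ≤ F * M) :
    2 ^ m ≤ cacheSize F M := by
  refine Nat.le_floor ?_
  push_cast
  rw [← Real.rpow_natCast]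
  exact Real.rpow_le_rpow_of_exponent_le one_le_two h

/-- A cache of `F * M` bits can store the positions in `s` of all `N` files. -/
theorem exists_cache {N F : ℕ} {M : ℝ} {P : Type} (s : Finset P)
    (hs : (N : ℝ) * s.card ≤ F * M) :
    ∃ g : (Fin N → P → ZMod 2) → Fin (cacheSize F M),
      ∀ w w', g w = g w' → AgreeOn s w w' := by
  classical
  obtain ⟨e⟩ : Nonempty ((Fin N → s → ZMod 2) ↪ Fin (cacheSize F M)) := by
    refine Function.Embedding.nonempty_of_card_le ?_
    have h : Fintype.card (Fin N → s → ZMod 2) = 2 ^ (N * s.card) := by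
      simp [← pow_mul, ZMod.card, mul_comm]
    rw [h, Fintype.card_fin]
    refine two_pow_le_cacheSize ?_
    push_cast
    exact hs
  refine ⟨fun w => e fun f p => w f p, fun w w' h f p hp => ?_⟩
  exact congrFun (congrFun (e.injective h) f) ⟨p, hp⟩

/-- Encoders and decoders need not be given explicitly: it is enough that each relay signal is
determined by what the relay knows, and each requested file by what the user knows. -/
theorem exists_scheme_of_determined {N K₁ K₂ F : ℕ} {M₁ M₂ : ℝ} {P : Type} [Fintype P]
    (hP : Fintype.card P = F)
    (c : Fin K₁ → Finset P) (u : Fin K₁ → Fin K₂ → Finset P)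
    (hc : ∀ i, (N : ℝ) * (c i).card ≤ F * M₁)
    (hu : ∀ i j, (N : ℝ) * (u i j).card ≤ F * M₂)
    (n : ℕ) (X : Demand N K₁ K₂ → Fin n → (Fin N → P → ZMod 2) → ZMod 2)
    (Y : Fin K₁ → Demand N K₁ K₂ → Fin n → (Fin N → P → ZMod 2) → ZMod 2)
    (hY : ∀ i d t w w', AgreeOn (c i) w w' → (∀ s < t, X d s w = X d s w') →
      Y i d t w = Y i d t w')
    (hdec : ∀ d i j w w', AgreeOn (u i j) w w' → (∀ t, Y i d t w = Y i d t w') →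
      w (d i j) = w' (d i j)) :
    ∃ c : CachingScheme N K₁ K₂ F M₁ M₂,
      (∀ d, c.slots d = n) ∧ ∀ d i j, c.errorProb d i j = 0 := by
  classical
  obtain ⟨e⟩ : Nonempty (Fin (2 ^ F) ≃ (P → ZMod 2)) :=
    ⟨Fintype.equivOfCardEq (by simp [hP, ZMod.card])⟩
  obtain ⟨b⟩ : Nonempty (ZMod 2 ≃ Bool) := ⟨Fintype.equivOfCardEq (by simp [ZMod.card])⟩
  choose gr hgr using fun i => exists_cache (N := N) (c i) (hc i)
  choose gu hgu using fun i j => exists_cache (N := N) (u i j) (hu i j)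
  let L : Library N F → Fin N → P → ZMod 2 := fun w f => e (w f)
  have h1 : ∀ (i : Fin K₁) (d : Demand N K₁ K₂) (t : Fin n),
      ∃ E : Fin (cacheSize F M₁) × (Fin (t : ℕ) → Bool) → Bool,
        (fun w => b (Y i d t (L w))) = E ∘ fun w => (gr i (L w),
          fun s : Fin (t : ℕ) => b (X d ⟨s, s.isLt.trans t.isLt⟩ (L w))) := by
    intro i d t
    refine (Function.factorsThrough_iff _).1 ?_
    intro w w' h
    simp only [Prod.mk.injEq] at h
    refine congrArg b (hY i d t _ _ (hgr _ _ _ h.1) fun s hs => ?_)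
    exact b.injective (congrFun h.2 ⟨s, hs⟩)
  choose E hE using h1
  have h2 : ∀ (i : Fin K₁) (j : Fin K₂) (d : Demand N K₁ K₂),
      ∃ D : (Fin n → Bool) × Fin (cacheSize F M₂) → Fin (2 ^ F),
        (fun w : Library N F => w (d i j)) =
          D ∘ fun w => (fun t => b (Y i d t (L w)), gu i j (L w)) := by
    intro i j d
    have : Nonempty (Fin (2 ^ F)) := ⟨⟨0, by positivity⟩⟩
    refine (Function.factorsThrough_iff _).1 ?_
    intro w w' h
    simp only [Prod.mk.injEq] at h
    refine e.injective (hdec d i j (L w) (L w') (hgu _ _ _ _ h.2) fun t => ?_)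
    exact b.injective (congrFun h.1 t)
  choose D hD using h2
  let C : CachingScheme N K₁ K₂ F M₁ M₂ :=
    { relayCache := fun i w => gr i (L w)
      userCache := fun i j w => gu i j (L w)
      slots := fun _ => n
      serverEnc := fun d t w => b (X d t (L w))
      relayEnc := fun i d t m s => E i d t (m, s)
      decode := fun i j d y m => D i j d (y, m) }
  refine ⟨C, fun _ => rfl, fun d i j => ?_⟩
  have hsig : ∀ w, C.relaySignal d i w = fun t => b (Y i d t (L w)) := fun w =>
    funext fun t => (congrFun (hE i d t) w).symm
  have hest : ∀ w, C.estimate d i j w = w (d i j) := by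
    intro w
    have h := congrFun (hD i j d) w
    simp only [CachingScheme.estimate, hsig]
    exact h.symm
  simp [CachingScheme.errorProb, hest]

/-- Scheduling. If every message of a relay is a function of its cache and of at most one server
message, no server message being used twice, then the server and the relays can work
concurrently: a message that depends on a server message is sent one slot after it, and the
remaining ones fill the free slots. -/
theorem exists_scheme_of_messages {N K₁ K₂ F : ℕ} {M₁ M₂ : ℝ} {P : Type} [Fintype P]
    (hP : Fintype.card P = F)
    (c : Fin K₁ → Finset P) (u : Fin K₁ → Fin K₂ → Finset P)
    (hc : ∀ i, (N : ℝ) * (c i).card ≤ F * M₁)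
    (hu : ∀ i j, (N : ℝ) * (u i j).card ≤ F * M₂)
    {S : Type} [Fintype S] {R : Fin K₁ → Type} [∀ i, Fintype (R i)]
    (X : Demand N K₁ K₂ → S → (Fin N → P → ZMod 2) → ZMod 2)
    (V : ∀ i, Demand N K₁ K₂ → R i → (Fin N → P → ZMod 2) → ZMod 2)
    (src : ∀ i, R i → Option S)
    (hsrc : ∀ i r r' m, src i r = some m → src i r' = some m → r = r')
    (hV : ∀ i d r w w', AgreeOn (c i) w w' → (∀ m, src i r = some m → X d m w = X d m w') →
      V i d r w = V i d r w')
    (hdec : ∀ d i j w w', AgreeOn (u i j) w w' → (∀ r, V i d r w = V i d r w') →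
      w (d i j) = w' (d i j))
    (n : ℕ) (hS : Fintype.card S < n) (hR : ∀ i, Fintype.card (R i) ≤ n) :
    ∃ c : CachingScheme N K₁ K₂ F M₁ M₂,
      (∀ d, c.slots d = n) ∧ ∀ d i j, c.errorProb d i j = 0 := by
  classical
  let e := Fintype.equivFin S
  have hn : 0 < n := by omega
  have hslot : ∀ m, (e m : ℕ) + 1 < n := fun m => by have := (e m).isLt; omega
  -- Slots for the relay messages, one slot later than the server messages they depend on.
  have hφ : ∀ i, ∃ φ : R i → Fin n, Function.Injective φ ∧
      ∀ r m, src i r = some m → φ r = ⟨e m + 1, hslot m⟩ := by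
    intro i
    let f : R i → Fin n := fun r =>
      (src i r).elim ⟨0, hn⟩ fun m => ⟨e m + 1, hslot m⟩
    let s : Finset (R i) := Finset.univ.filter fun r => (src i r).isSome
    have hinj : Set.InjOn f s := by
      intro r hr r' hr' h
      simp only [s, Finset.coe_filter, Finset.mem_univ, true_and, Set.mem_ofPred_eq,
        Option.isSome_iff_exists] at hr hr'
      obtain ⟨m, hm⟩ := hr
      obtain ⟨m', hm'⟩ := hr'
      simp only [f, hm, hm', Option.elim_some, Fin.mk.injEq, add_left_inj] at h
      have : m = m' := e.injective (Fin.ext h)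
      subst this
      exact hsrc i r r' m hm hm'
    obtain ⟨t, hst, -, ht⟩ := Finset.exists_subsuperset_card_eq
      (Finset.subset_univ (s.image f)) (n := Fintype.card (R i))
      (Finset.card_image_le.trans (Finset.card_le_univ s)) (by simpa using hR i)
    obtain ⟨g, hg⟩ := Finset.exists_equiv_extend_of_card_eq ht.symm hst hinj
    refine ⟨fun r => g r, Subtype.val_injective.comp g.injective, fun r m hm => ?_⟩
    refine (hg r (by simp [s, hm])).trans ?_
    simp [f, hm]
  choose φ hφi hφs using hφ
  refine exists_scheme_of_determined hP c u hc hu n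
    (fun d t w => if h : ∃ m, (e m : ℕ) = t then X d h.choose w else 0)
    (fun i d t w => if h : ∃ r, φ i r = t then V i d h.choose w else 0) ?_ ?_
  · intro i d t w w' hw hX
    by_cases h : ∃ r, φ i r = t
    · simp only [h, dite_true]
      refine hV i d _ w w' hw fun m hm => ?_
      have ht := (hφs i _ m hm).symm.trans h.choose_spec
      have hm' : ∃ m', (e m' : ℕ) = ((⟨e m, by have := hslot m; omega⟩ : Fin n) : ℕ) := ⟨m, rfl⟩
      have hmm : hm'.choose = m := e.injective (Fin.ext hm'.choose_spec)
      have := hX ⟨e m, by have := hslot m; omega⟩ (lt_of_lt_of_eq (by simp [Fin.lt_def]) ht)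
      simp only [dif_pos hm', hmm] at this
      exact this
    · simp [h]
  · intro d i j w w' hw hY
    refine hdec d i j w w' hw fun r => ?_
    have h : ∃ r', φ i r' = φ i r := ⟨r, rfl⟩
    have := hY (φ i r)
    simpa only [dif_pos h, hφi i h.choose_spec] using this

/-! ### Placement and delivery -/

/-- The bit positions of a file. A position `Sum.inl ⟨B, k⟩` is cached by the users in `B` and by
no relay. A position `Sum.inr ⟨(S, A), k⟩` is cached by the relays in `S` and, at every relay,
by the users whose number is in `A`. The sizes of the pieces depend only on cardinalities. -/
abbrev Position (K₁ K₂ : ℕ) (n₀ : ℕ → ℕ) (n₁ : ℕ → ℕ → ℕ) : Type :=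
  (Σ B : Finset (Fin K₁ × Fin K₂), Fin (n₀ B.card)) ⊕
    (Σ T : Finset (Fin K₁) × Finset (Fin K₂), Fin (n₁ T.1.card T.2.card))

/-- The messages of the server: one for each nonempty set of users and one for each pair of a set
of relays and a nonempty set of user numbers, repeated along the corresponding pieces. -/
abbrev ServerMsg (K₁ K₂ : ℕ) (n₀ : ℕ → ℕ) (n₁ : ℕ → ℕ → ℕ) : Type :=
  (Σ A : {A : Finset (Fin K₁ × Fin K₂) // A.Nonempty}, Fin (n₀ (A.1.card - 1))) ⊕
    (Σ T : Finset (Fin K₁) × {A : Finset (Fin K₂) // A.Nonempty},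
      Fin (n₁ (T.1.card - 1) (T.2.1.card - 1)))

/-- The messages of relay `i`: one for each set of users that meets its own users, and one for
each pair of a set `S` of relays and a nonempty set `A` of its users; the latter serves the users
in `A` with positions that are cached by the relays in `S`. -/
abbrev RelayMsg {K₁ : ℕ} (K₂ : ℕ) (n₀ : ℕ → ℕ) (n₁ : ℕ → ℕ → ℕ) (i : Fin K₁) : Type :=
  (Σ A : {A : Finset (Fin K₁ × Fin K₂) // ∃ j, (i, j) ∈ A}, Fin (n₀ (A.1.card - 1))) ⊕
    (Σ T : Finset (Fin K₁) × {A : Finset (Fin K₂) // A.Nonempty},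
      Fin (n₁ T.1.card (T.2.1.card - 1)))

section Delivery

variable {N K₁ K₂ : ℕ} {n₀ : ℕ → ℕ} {n₁ : ℕ → ℕ → ℕ}

/-- The positions cached by relay `i`. -/
def relayPositions (i : Fin K₁) : Finset (Position K₁ K₂ n₀ n₁) :=
  Finset.disjSum ∅ ((Finset.univ.filter fun T => i ∈ T.1).sigma fun _ => Finset.univ)

/-- The positions cached by the `j`-th user of relay `i`. -/
def userPositions (i : Fin K₁) (j : Fin K₂) : Finset (Position K₁ K₂ n₀ n₁) :=
  Finset.disjSum ((Finset.univ.filter fun B => (i, j) ∈ B).sigma fun _ => Finset.univ)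
    ((Finset.univ.filter fun T => j ∈ T.2).sigma fun _ => Finset.univ)

/-- The `k`-th bit of the piece of a file that is cached by the users in `B` only; it is `0`
beyond the end of the piece. -/
def userPiece (x : Position K₁ K₂ n₀ n₁ → ZMod 2) (B : Finset (Fin K₁ × Fin K₂)) (k : ℕ) :
    ZMod 2 :=
  if h : k < n₀ B.card then x (Sum.inl ⟨B, k, h⟩) else 0

/-- The `k`-th bit of the piece of a file that is cached by the relays in `S` and the users with
numbers in `A`; it is `0` beyond the end of the piece. -/
def relayPiece (x : Position K₁ K₂ n₀ n₁ → ZMod 2) (S : Finset (Fin K₁)) (A : Finset (Fin K₂))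
    (k : ℕ) : ZMod 2 :=
  if h : k < n₁ S.card A.card then x (Sum.inr ⟨(S, A), k, h⟩) else 0

/-- The coded multicast to the users in `A`. -/
def userCode (d : Demand N K₁ K₂) (w : Fin N → Position K₁ K₂ n₀ n₁ → ZMod 2)
    (A : Finset (Fin K₁ × Fin K₂)) (k : ℕ) : ZMod 2 :=
  ∑ v ∈ A, userPiece (w (d v.1 v.2)) (A.erase v) k

/-- The coded multicast of relay `i` to its users with numbers in `A`, for the positions that are
cached by the relays in `S`. -/
def relayCode (d : Demand N K₁ K₂) (w : Fin N → Position K₁ K₂ n₀ n₁ → ZMod 2) (i : Fin K₁)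
    (S : Finset (Fin K₁)) (A : Finset (Fin K₂)) (k : ℕ) : ZMod 2 :=
  ∑ j ∈ A, relayPiece (w (d i j)) S (A.erase j) k

theorem userPiece_eq_of_mem {w w' : Fin N → Position K₁ K₂ n₀ n₁ → ZMod 2} {i : Fin K₁}
    {j : Fin K₂} (h : AgreeOn (userPositions i j) w w') {B : Finset (Fin K₁ × Fin K₂)}
    (hB : (i, j) ∈ B) (f : Fin N) (k : ℕ) : userPiece (w f) B k = userPiece (w' f) B k := by
  unfold userPiece
  split_ifs with hk
  · exact h _ _ (by simp [userPositions, hB])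
  · rfl

theorem relayPiece_eq_of_mem_user {w w' : Fin N → Position K₁ K₂ n₀ n₁ → ZMod 2} {i : Fin K₁}
    {j : Fin K₂} (h : AgreeOn (userPositions i j) w w') (S : Finset (Fin K₁))
    {A : Finset (Fin K₂)} (hA : j ∈ A) (f : Fin N) (k : ℕ) :
    relayPiece (w f) S A k = relayPiece (w' f) S A k := by
  unfold relayPiece
  split_ifs with hk
  · exact h _ _ (by simp [userPositions, hA])
  · rfl

theorem relayCode_eq_of_mem {w w' : Fin N → Position K₁ K₂ n₀ n₁ → ZMod 2} {i : Fin K₁}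
    (h : AgreeOn (relayPositions i) w w') (d : Demand N K₁ K₂) (i' : Fin K₁)
    {S : Finset (Fin K₁)} (hS : i ∈ S) (A : Finset (Fin K₂)) (k : ℕ) :
    relayCode d w i' S A k = relayCode d w' i' S A k := by
  refine Finset.sum_congr rfl fun j _ => ?_
  unfold relayPiece
  split_ifs with hk
  · exact h _ _ (by simp [relayPositions, hS])
  · rfl

/-- The value of a server message. The second kind superimposes, over the relays `i` in `Q`, what
relay `i` sends for the positions cached by the other relays in `Q`. -/
def serverValue (d : Demand N K₁ K₂) (m : ServerMsg K₁ K₂ n₀ n₁)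
    (w : Fin N → Position K₁ K₂ n₀ n₁ → ZMod 2) : ZMod 2 :=
  m.elim (fun a => userCode d w a.1.1 a.2)
    fun a => ∑ i ∈ a.1.1, relayCode d w i (a.1.1.erase i) a.1.2.1 a.2

/-- The value of a message of relay `i`. -/
def relayValue (i : Fin K₁) (d : Demand N K₁ K₂) (r : RelayMsg K₂ n₀ n₁ i)
    (w : Fin N → Position K₁ K₂ n₀ n₁ → ZMod 2) : ZMod 2 :=
  r.elim (fun a => userCode d w a.1.1 a.2) fun a => relayCode d w i a.1.1 a.1.2.1 a.2

/-- The server message from which relay `i` extracts its message; none if relay `i` has all the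
bits involved in its cache. -/
def relaySource (i : Fin K₁) (r : RelayMsg K₂ n₀ n₁ i) : Option (ServerMsg K₁ K₂ n₀ n₁) :=
  r.elim (fun a => some (Sum.inl ⟨⟨a.1.1, a.1.2.elim fun _ h => ⟨_, h⟩⟩, a.2⟩))
    fun a => if h : i ∈ a.1.1 then none
      else some (Sum.inr ⟨(insert i a.1.1, a.1.2), a.2, by
        simpa only [Finset.card_insert_of_notMem h, Nat.add_sub_cancel] using a.2.isLt⟩)

theorem relaySource_injective (i : Fin K₁) (r r' : RelayMsg K₂ n₀ n₁ i)
    (m : ServerMsg K₁ K₂ n₀ n₁) (h : relaySource i r = some m) (h' : relaySource i r' = some m) :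
    r = r' := by
  rcases r with ⟨⟨A, hA⟩, k⟩ | ⟨⟨S, A⟩, k⟩ <;> rcases r' with ⟨⟨A', hA'⟩, k'⟩ | ⟨⟨S', A'⟩, k'⟩
  · simp only [relaySource, Sum.elim_inl, Option.some.injEq] at h h'
    subst h
    simp only [Sum.inl.injEq, Sigma.mk.injEq, Subtype.mk.injEq] at h'
    obtain ⟨rfl, h2⟩ := h'
    simp only [heq_eq_eq] at h2
    rw [h2]
  · simp only [relaySource, Sum.elim_inl, Sum.elim_inr, Option.some.injEq] at h h'
    subst h
    split_ifs at h'
    simp at h'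
  · simp only [relaySource, Sum.elim_inl, Sum.elim_inr, Option.some.injEq] at h h'
    subst h'
    split_ifs at h
    simp at h
  · simp only [relaySource, Sum.elim_inr] at h h'
    split_ifs at h h' with hS hS'
    simp only [Option.some.injEq] at h h'
    subst h
    simp only [Sum.inr.injEq, Sigma.mk.injEq, Prod.mk.injEq] at h'
    obtain ⟨⟨h1, rfl⟩, h2⟩ := h'
    have h3 : S' = S := by
      rw [← Finset.erase_insert hS', h1, Finset.erase_insert hS]
    subst h3
    simp only [heq_eq_eq, Fin.mk.injEq] at h2
    rw [Fin.ext h2]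

/-- A relay computes its messages: the terms for the other relays in a server message concern
positions that it caches, so it can subtract them. -/
theorem relayValue_eq (i : Fin K₁) (d : Demand N K₁ K₂) (r : RelayMsg K₂ n₀ n₁ i)
    (w w' : Fin N → Position K₁ K₂ n₀ n₁ → ZMod 2) (hw : AgreeOn (relayPositions i) w w')
    (hX : ∀ m, relaySource i r = some m → serverValue d m w = serverValue d m w') :
    relayValue i d r w = relayValue i d r w' := by
  rcases r with ⟨⟨A, hA⟩, k⟩ | ⟨⟨S, A⟩, k⟩
  · exact hX _ rfl
  · by_cases hS : i ∈ S
    · exact relayCode_eq_of_mem hw d i hS _ _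
    · have h := hX _ (by simp only [relaySource, Sum.elim_inr, hS, dite_false]; rfl)
      simp only [serverValue, Sum.elim_inr, Finset.sum_insert hS, Finset.erase_insert hS] at h
      have h2 : ∀ i' ∈ S, relayCode d w i' ((insert i S).erase i') A.1 k =
          relayCode d w' i' ((insert i S).erase i') A.1 k := fun i' hi' =>
        relayCode_eq_of_mem hw d i' (Finset.mem_erase.2
          ⟨fun h => hS (h ▸ hi'), Finset.mem_insert_self _ _⟩) _ _
      rw [Finset.sum_congr rfl h2] at h
      exact add_right_cancel h

/-- A user recovers its file: each bit that it does not cache is one term of a message of its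
relay in which it caches the other terms. -/
theorem eq_of_relayValue_eq (d : Demand N K₁ K₂) (i : Fin K₁) (j : Fin K₂)
    (w w' : Fin N → Position K₁ K₂ n₀ n₁ → ZMod 2) (hw : AgreeOn (userPositions i j) w w')
    (hV : ∀ r, relayValue i d r w = relayValue i d r w') : w (d i j) = w' (d i j) := by
  funext p
  rcases p with ⟨B, k⟩ | ⟨⟨S, A⟩, k⟩
  · by_cases hB : (i, j) ∈ B
    · exact hw _ _ (by simp [userPositions, hB])
    have h := hV (Sum.inl ⟨⟨insert (i, j) B, j, Finset.mem_insert_self _ _⟩, k, by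
        simpa only [Finset.card_insert_of_notMem hB, Nat.add_sub_cancel] using k.isLt⟩)
    simp only [relayValue, Sum.elim_inl, userCode, Finset.sum_insert hB,
      Finset.erase_insert hB] at h
    have h2 : ∀ v ∈ B, userPiece (w (d v.1 v.2)) ((insert (i, j) B).erase v) k =
        userPiece (w' (d v.1 v.2)) ((insert (i, j) B).erase v) k := fun v hv =>
      userPiece_eq_of_mem hw (Finset.mem_erase.2
        ⟨fun h => hB (h ▸ hv), Finset.mem_insert_self _ _⟩) _ _
    rw [Finset.sum_congr rfl h2] at h
    simpa only [userPiece, k.isLt, dite_true] using add_right_cancel h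
  · by_cases hA : j ∈ A
    · exact hw _ _ (by simp [userPositions, hA])
    have h := hV (Sum.inr ⟨(S, ⟨insert j A, j, Finset.mem_insert_self _ _⟩), k, by
        simpa only [Finset.card_insert_of_notMem hA, Nat.add_sub_cancel] using k.isLt⟩)
    simp only [relayValue, Sum.elim_inr, relayCode, Finset.sum_insert hA,
      Finset.erase_insert hA] at h
    have h2 : ∀ v ∈ A, relayPiece (w (d i v)) S ((insert j A).erase v) k =
        relayPiece (w' (d i v)) S ((insert j A).erase v) k := fun v hv =>
      relayPiece_eq_of_mem_user hw S (Finset.mem_erase.2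
        ⟨fun h => hA (h ▸ hv), Finset.mem_insert_self _ _⟩) _ _
    rw [Finset.sum_congr rfl h2] at h
    simpa only [relayPiece, k.isLt, dite_true] using add_right_cancel h

theorem card_relayPositions (i : Fin K₁) :
    (relayPositions i : Finset (Position K₁ K₂ n₀ n₁)).card =
      ∑ T : Finset (Fin K₁) × Finset (Fin K₂) with i ∈ T.1, n₁ T.1.card T.2.card := by
  simp [relayPositions]

theorem card_userPositions (i : Fin K₁) (j : Fin K₂) :
    (userPositions i j : Finset (Position K₁ K₂ n₀ n₁)).card =
      ∑ B : Finset (Fin K₁ × Fin K₂) with (i, j) ∈ B, n₀ B.card +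
      ∑ T : Finset (Fin K₁) × Finset (Fin K₂) with j ∈ T.2, n₁ T.1.card T.2.card := by
  simp [userPositions]

theorem card_serverMsg : Fintype.card (ServerMsg K₁ K₂ n₀ n₁) =
    ∑ A : Finset (Fin K₁ × Fin K₂) with A.Nonempty, n₀ (A.card - 1) +
    ∑ Q : Finset (Fin K₁), ∑ A : Finset (Fin K₂) with A.Nonempty,
      n₁ (Q.card - 1) (A.card - 1) := by
  simp only [ServerMsg, Fintype.card_sum, Fintype.card_sigma, Fintype.card_fin,
    Fintype.sum_prod_type]
  congr 1
  · exact (Finset.sum_subtype _ (by simp) fun A : Finset (Fin K₁ × Fin K₂) =>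
      n₀ (A.card - 1)).symm
  · exact Finset.sum_congr rfl fun Q _ =>
      (Finset.sum_subtype _ (by simp) fun A : Finset (Fin K₂) =>
        n₁ (Q.card - 1) (A.card - 1)).symm

theorem card_relayMsg (i : Fin K₁) : Fintype.card (RelayMsg K₂ n₀ n₁ i) =
    ∑ A : Finset (Fin K₁ × Fin K₂) with ∃ j, (i, j) ∈ A, n₀ (A.card - 1) +
    ∑ S : Finset (Fin K₁), ∑ A : Finset (Fin K₂) with A.Nonempty,
      n₁ S.card (A.card - 1) := by
  simp only [RelayMsg, Fintype.card_sum, Fintype.card_sigma, Fintype.card_fin,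
    Fintype.sum_prod_type]
  congr 1
  · exact (Finset.sum_subtype _ (by simp) fun A : Finset (Fin K₁ × Fin K₂) =>
      n₀ (A.card - 1)).symm
  · exact Finset.sum_congr rfl fun S _ =>
      (Finset.sum_subtype _ (by simp) fun A : Finset (Fin K₂) =>
        n₁ S.card (A.card - 1)).symm

end Delivery

/-! ### Rounding the piece sizes -/

/-- Real fractions of a file that add up to one can be rounded down to numbers of bits, with the
bounded remainder added to the piece that no node caches. -/
theorem exists_pieceSizes (K₁ K₂ : ℕ) (x₀ : ℕ → ℝ) (x₁ : ℕ → ℕ → ℝ) (h₀ : ∀ b, 0 ≤ x₀ b)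
    (h₁ : ∀ s a, 0 ≤ x₁ s a)
    (hsum : ∑ B : Finset (Fin K₁ × Fin K₂), x₀ B.card +
      ∑ T : Finset (Fin K₁) × Finset (Fin K₂), x₁ T.1.card T.2.card = 1) :
    ∃ C : ℝ, 0 ≤ C ∧ ∀ F : ℕ, ∃ (n₀ : ℕ → ℕ) (n₁ : ℕ → ℕ → ℕ),
      (∑ B : Finset (Fin K₁ × Fin K₂), n₀ B.card +
        ∑ T : Finset (Fin K₁) × Finset (Fin K₂), n₁ T.1.card T.2.card = F) ∧
      (∀ b, b ≠ 0 → (n₀ b : ℝ) ≤ F * x₀ b) ∧ (∀ s a, (n₁ s a : ℝ) ≤ F * x₁ s a) ∧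
      (n₀ 0 : ℝ) ≤ F * x₀ 0 + C := by
  classical
  set E : Finset (Finset (Fin K₁ × Fin K₂)) := Finset.univ.erase ∅ with hE
  have hsplit : ∀ {β : Type} [AddCommMonoid β] (f : ℕ → β),
      ∑ B : Finset (Fin K₁ × Fin K₂), f B.card = f 0 + ∑ B ∈ E, f B.card := fun f =>
    (Finset.add_sum_erase Finset.univ (fun B : Finset (Fin K₁ × Fin K₂) => f B.card)
      (Finset.mem_univ ∅)).symm
  refine ⟨E.card + Fintype.card (Finset (Fin K₁) × Finset (Fin K₂)), by positivity,
    fun F => ?_⟩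
  have hF : (0 : ℝ) ≤ F := F.cast_nonneg
  set rest : ℕ := ∑ B ∈ E, ⌊F * x₀ B.card⌋₊ +
    ∑ T : Finset (Fin K₁) × Finset (Fin K₂), ⌊F * x₁ T.1.card T.2.card⌋₊ with hrest
  have hle0 : ∀ b, (⌊F * x₀ b⌋₊ : ℝ) ≤ F * x₀ b := fun b =>
    Nat.floor_le (mul_nonneg hF (h₀ b))
  have hle1 : ∀ s a, (⌊F * x₁ s a⌋₊ : ℝ) ≤ F * x₁ s a := fun s a =>
    Nat.floor_le (mul_nonneg hF (h₁ s a))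
  have htotal : F * ∑ B ∈ E, x₀ B.card +
      F * ∑ T : Finset (Fin K₁) × Finset (Fin K₂), x₁ T.1.card T.2.card = F - F * x₀ 0 := by
    rw [hsplit] at hsum
    linear_combination (F : ℝ) * hsum
  have hrestF : rest ≤ F := by
    have : (rest : ℝ) ≤ F := by
      have h1 := Finset.sum_le_sum fun (B : Finset (Fin K₁ × Fin K₂)) (_ : B ∈ E) =>
        hle0 B.card
      have h2 := Finset.sum_le_sum fun (T : Finset (Fin K₁) × Finset (Fin K₂))
        (_ : T ∈ Finset.univ) => hle1 T.1.card T.2.card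
      rw [← Finset.mul_sum] at h1 h2
      have := mul_nonneg hF (h₀ 0)
      push_cast [hrest]
      linarith
    exact_mod_cast this
  refine ⟨fun b => if b = 0 then F - rest else ⌊F * x₀ b⌋₊, fun s a => ⌊F * x₁ s a⌋₊,
    ?_, fun b hb => ?_, hle1, ?_⟩
  · rw [hsplit fun b => if b = 0 then F - rest else ⌊F * x₀ b⌋₊]
    have : ∑ B ∈ E, (if B.card = 0 then F - rest else ⌊F * x₀ B.card⌋₊) =
        ∑ B ∈ E, ⌊F * x₀ B.card⌋₊ :=
      Finset.sum_congr rfl fun B hB => if_neg (by simpa [hE] using hB)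
    dsimp only
    rw [this, if_pos rfl]
    omega
  · simpa [hb] using hle0 b
  · have h1 := Finset.sum_le_sum fun (B : Finset (Fin K₁ × Fin K₂)) (_ : B ∈ E) =>
      (Nat.lt_floor_add_one ((F : ℝ) * x₀ B.card)).le
    have h2 := Finset.sum_le_sum fun (T : Finset (Fin K₁) × Finset (Fin K₂))
      (_ : T ∈ Finset.univ) => (Nat.lt_floor_add_one ((F : ℝ) * x₁ T.1.card T.2.card)).le
    rw [← Finset.mul_sum, Finset.sum_add_distrib, Finset.sum_const, nsmul_one] at h1 h2
    dsimp only
    rw [if_pos rfl, Nat.cast_sub hrestF]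
    push_cast [hrest]
    rw [Finset.card_univ] at h2
    linarith

/-- The delay of the scheme in terms of the piece sizes: the maximum of the load of the server and
the loads of the relays. -/
theorem optimalDelay_le_of_pieces {N K₁ K₂ : ℕ} {M₁ M₂ : ℝ} (x₀ : ℕ → ℝ) (x₁ : ℕ → ℕ → ℝ)
    (h₀ : ∀ b, 0 ≤ x₀ b) (h₁ : ∀ s a, 0 ≤ x₁ s a)
    (hsum : ∑ B : Finset (Fin K₁ × Fin K₂), x₀ B.card +
      ∑ T : Finset (Fin K₁) × Finset (Fin K₂), x₁ T.1.card T.2.card = 1)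
    (hrel : ∀ i : Fin K₁, (N : ℝ) *
      ∑ T : Finset (Fin K₁) × Finset (Fin K₂) with i ∈ T.1, x₁ T.1.card T.2.card ≤ M₁)
    (huser : ∀ (i : Fin K₁) (j : Fin K₂), (N : ℝ) *
      (∑ B : Finset (Fin K₁ × Fin K₂) with (i, j) ∈ B, x₀ B.card +
        ∑ T : Finset (Fin K₁) × Finset (Fin K₂) with j ∈ T.2, x₁ T.1.card T.2.card) ≤ M₂)
    (ρ : ℝ)
    (hserver : ∑ A : Finset (Fin K₁ × Fin K₂) with A.Nonempty, x₀ (A.card - 1) +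
      ∑ Q : Finset (Fin K₁), ∑ A : Finset (Fin K₂) with A.Nonempty,
        x₁ (Q.card - 1) (A.card - 1) ≤ ρ)
    (hrelay : ∀ i : Fin K₁,
      ∑ A : Finset (Fin K₁ × Fin K₂) with ∃ j, (i, j) ∈ A, x₀ (A.card - 1) +
      ∑ S : Finset (Fin K₁), ∑ A : Finset (Fin K₂) with A.Nonempty,
        x₁ S.card (A.card - 1) ≤ ρ) :
    optimalDelay N K₁ K₂ M₁ M₂ ≤ (ρ : EReal) := by
  classical
  obtain ⟨C, hC, hn⟩ := exists_pieceSizes K₁ K₂ x₀ x₁ h₀ h₁ hsum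
  set C' : ℝ := Fintype.card (Finset (Fin K₁ × Fin K₂)) * C
  have hC'0 : 0 ≤ C' := by positivity
  -- Rounding costs only a bounded number of slots, which any increase of the delay absorbs.
  have key : ∀ T : ℝ, ρ < T → DelayAchievable N K₁ K₂ M₁ M₂ T := by
    intro T hT ε hε
    refine ⟨⌈(C' + 1) / (T - ρ)⌉₊ + 1, fun F hF => ?_⟩
    have hF0 : (0 : ℝ) < F := by exact_mod_cast (show 0 < F by omega)
    obtain ⟨n₀, n₁, hnF, hn₀, hn₁, hn00⟩ := hn F
    have hn₀' : ∀ b, (n₀ b : ℝ) ≤ F * x₀ b + C := by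
      intro b
      by_cases hb : b = 0
      · rw [hb]; exact hn00
      · have := hn₀ b hb; linarith
    have hsum₀ : ∀ s : Finset (Finset (Fin K₁ × Fin K₂)),
        ((∑ A ∈ s, n₀ (A.card - 1) : ℕ) : ℝ) ≤ F * (∑ A ∈ s, x₀ (A.card - 1)) + C' := by
      intro s
      push_cast
      refine (Finset.sum_le_sum fun A _ => hn₀' (A.card - 1)).trans ?_
      rw [Finset.sum_add_distrib, Finset.sum_const, nsmul_eq_mul, Finset.mul_sum]
      have : (s.card : ℝ) ≤ Fintype.card (Finset (Fin K₁ × Fin K₂)) := by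
        exact_mod_cast Finset.card_le_univ s
      have := mul_le_mul_of_nonneg_right this hC
      linarith
    have hS : (Fintype.card (ServerMsg K₁ K₂ n₀ n₁) : ℝ) ≤ F * ρ + C' := by
      rw [card_serverMsg, Nat.cast_add]
      refine (add_le_add (hsum₀ _) (d := F * ∑ Q : Finset (Fin K₁),
        ∑ A : Finset (Fin K₂) with A.Nonempty, x₁ (Q.card - 1) (A.card - 1)) ?_).trans ?_
      · push_cast
        simp only [Finset.mul_sum]
        exact Finset.sum_le_sum fun Q _ => Finset.sum_le_sum fun A _ => hn₁ _ _
      · have := mul_le_mul_of_nonneg_left hserver hF0.le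
        linarith
    have hR : ∀ i, (Fintype.card (RelayMsg K₂ n₀ n₁ (i : Fin K₁)) : ℝ) ≤ F * ρ + C' := by
      intro i
      rw [card_relayMsg, Nat.cast_add]
      refine (add_le_add (hsum₀ _) (d := F * ∑ S : Finset (Fin K₁),
        ∑ A : Finset (Fin K₂) with A.Nonempty, x₁ S.card (A.card - 1)) ?_).trans ?_
      · push_cast
        simp only [Finset.mul_sum]
        exact Finset.sum_le_sum fun Q _ => Finset.sum_le_sum fun A _ => hn₁ _ _
      · have := mul_le_mul_of_nonneg_left (hrelay i) hF0.le
        linarith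
    have hN : (0 : ℝ) ≤ N := N.cast_nonneg
    obtain ⟨c, hc, herr⟩ := exists_scheme_of_messages (N := N) (M₁ := M₁) (M₂ := M₂)
      (P := Position K₁ K₂ n₀ n₁) (F := F) (by simpa using hnF)
      relayPositions userPositions
      (fun i => by
        rw [card_relayPositions]
        push_cast
        have h := Finset.sum_le_sum fun (T : Finset (Fin K₁) × Finset (Fin K₂))
          (_ : T ∈ Finset.univ.filter fun T => i ∈ T.1) => hn₁ T.1.card T.2.card
        rw [← Finset.mul_sum] at h
        have h2 := mul_le_mul_of_nonneg_left h hN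
        have h3 := mul_le_mul_of_nonneg_left (hrel i) hF0.le
        linarith)
      (fun i j => by
        rw [card_userPositions]
        push_cast
        have h := Finset.sum_le_sum fun (B : Finset (Fin K₁ × Fin K₂))
          (hB : B ∈ Finset.univ.filter fun B => (i, j) ∈ B) =>
            hn₀ B.card (Finset.card_ne_zero_of_mem (Finset.mem_filter.1 hB).2)
        have h' := Finset.sum_le_sum fun (T : Finset (Fin K₁) × Finset (Fin K₂))
          (_ : T ∈ Finset.univ.filter fun T => j ∈ T.2) => hn₁ T.1.card T.2.card
        rw [← Finset.mul_sum] at h h'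
        have h2 := mul_le_mul_of_nonneg_left (add_le_add h h') hN
        have h3 := mul_le_mul_of_nonneg_left (huser i j) hF0.le
        linarith)
      serverValue relayValue relaySource relaySource_injective relayValue_eq
      eq_of_relayValue_eq (⌊F * ρ + C'⌋₊ + 1) (Nat.lt_succ_of_le (Nat.le_floor hS))
      (fun i => (Nat.le_floor (hR i)).trans (Nat.le_succ _))
    refine ⟨c, fun d i j => by rw [herr]; exact hε, fun d => ?_⟩
    rw [CachingScheme.delay, hc, div_le_iff₀ hF0]
    have hfl := Nat.floor_le ((Nat.cast_nonneg _).trans hS)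
    have hF' : (C' + 1) / (T - ρ) ≤ F := by
      refine (Nat.le_ceil _).trans ?_
      exact_mod_cast (show ⌈(C' + 1) / (T - ρ)⌉₊ ≤ F by omega)
    rw [div_le_iff₀ (by linarith)] at hF'
    push_cast
    linarith
  refine EReal.le_of_forall_lt_iff_le.1 fun T hT => ?_
  exact sInf_le ⟨T, key T (by exact_mod_cast hT), rfl⟩

/-! ### Binomial weights -/

/-- The probability that `n` independent events of probability `q` occur exactly at a given set of
`k` of the `n` places. -/
def binWeight (q : ℝ) (n k : ℕ) : ℝ := q ^ k * (1 - q) ^ (n - k)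

theorem binWeight_nonneg {q : ℝ} (h₀ : 0 ≤ q) (h₁ : q ≤ 1) (n k : ℕ) : 0 ≤ binWeight q n k :=
  mul_nonneg (pow_nonneg h₀ _) (pow_nonneg (sub_nonneg.2 h₁) _)

theorem binWeight_add (q : ℝ) {m k : ℕ} (h : k ≤ m) (l : ℕ) :
    binWeight q (m + l) k = (1 - q) ^ l * binWeight q m k := by
  rw [binWeight, binWeight, Nat.sub_add_comm h, pow_add]
  ring

theorem sum_powerset_binWeight {ι : Type*} (q : ℝ) (s : Finset ι) :
    ∑ A ∈ s.powerset, binWeight q s.card A.card = 1 := by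
  simp only [binWeight]
  rw [Finset.sum_pow_mul_eq_add_pow]
  simp

theorem sum_binWeight (ι : Type*) [Fintype ι] (q : ℝ) :
    ∑ A : Finset ι, binWeight q (Fintype.card ι) A.card = 1 := by
  rw [← Finset.powerset_univ, ← Finset.card_univ]
  exact sum_powerset_binWeight q Finset.univ

theorem sum_binWeight_mem {ι : Type*} [Fintype ι] [DecidableEq ι] (q : ℝ) (i : ι) :
    ∑ A : Finset ι with i ∈ A, binWeight q (Fintype.card ι) A.card = q := by
  have h1 := Finset.sum_filter_add_sum_filter_not Finset.univ (fun A : Finset ι => i ∈ A)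
    fun A => binWeight q (Fintype.card ι) A.card
  rw [sum_binWeight] at h1
  have h2 : (Finset.univ.filter fun A : Finset ι => i ∉ A) =
      (Finset.univ.erase i).powerset := by
    ext A
    simp only [Finset.mem_filter, Finset.mem_univ, true_and, Finset.mem_powerset]
    exact ⟨fun h x hx => Finset.mem_erase.2 ⟨fun e => h (e ▸ hx), Finset.mem_univ _⟩,
      fun h hi => Finset.notMem_erase _ _ (h hi)⟩
  have hc : Fintype.card ι = (Finset.univ.erase i).card + 1 := by
    rw [Finset.card_erase_add_one (Finset.mem_univ i), Finset.card_univ]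
  have h3 : ∑ A : Finset ι with i ∉ A, binWeight q (Fintype.card ι) A.card = 1 - q := by
    rw [h2, hc]
    rw [Finset.sum_congr rfl fun A hA =>
      binWeight_add q (Finset.card_le_card (Finset.mem_powerset.1 hA)) 1, ← Finset.mul_sum,
      sum_powerset_binWeight]
    ring
  linarith

/-- The rate of decentralized coded caching as the total weight of its multicast messages, one for
each nonempty set `A` of users, with the weight of a piece cached by `#A - 1` users. -/
theorem sum_powerset_binWeight_pred {ι : Type*} [DecidableEq ι] {q : ℝ} (h₀ : 0 ≤ q)
    (h₁ : q ≤ 1) (s : Finset ι) :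
    ∑ A ∈ s.powerset with A.Nonempty, binWeight q s.card (A.card - 1) = rateDec q s.card := by
  have hnn : 0 ≤ ∑ A ∈ s.powerset with A.Nonempty, binWeight q s.card (A.card - 1) :=
    Finset.sum_nonneg fun A _ => binWeight_nonneg h₀ h₁ _ _
  by_cases hq : q = 0
  · subst hq
    have h : ∀ A ∈ s.powerset.filter Finset.Nonempty,
        binWeight 0 s.card (A.card - 1) = if A.card = 1 then 1 else 0 := by
      intro A hA
      have := Finset.card_pos.2 (Finset.mem_filter.1 hA).2
      by_cases h1 : A.card = 1
      · simp [binWeight, h1]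
      · rw [if_neg h1, binWeight, zero_pow (by omega), zero_mul]
    rw [Finset.sum_congr rfl h, Finset.sum_boole, Finset.filter_filter]
    have h2 : (s.powerset.filter fun A => A.Nonempty ∧ A.card = 1) = s.powersetCard 1 := by
      ext A
      simp only [Finset.mem_filter, Finset.mem_powerset, Finset.mem_powersetCard]
      exact ⟨fun h => ⟨h.1, h.2.2⟩, fun h => ⟨h.1, Finset.card_pos.1 (by omega), h.2⟩⟩
    rw [h2, Finset.card_powersetCard]
    simp [rateDec]
  · have h : ∀ A ∈ s.powerset.filter Finset.Nonempty,
        q * binWeight q s.card (A.card - 1) = (1 - q) * binWeight q s.card A.card := by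
      intro A hA
      obtain ⟨hA, hne⟩ := Finset.mem_filter.1 hA
      have hle := Finset.card_le_card (Finset.mem_powerset.1 hA)
      obtain ⟨k, hk⟩ := Nat.exists_eq_add_of_lt (Finset.card_pos.2 hne)
      rw [zero_add] at hk
      rw [hk, binWeight, binWeight, Nat.add_sub_cancel,
        show s.card - k = s.card - (k + 1) + 1 by omega]
      ring
    have hsum : ∑ A ∈ s.powerset with A.Nonempty, binWeight q s.card A.card =
        1 - (1 - q) ^ s.card := by
      have h1 := Finset.sum_filter_add_sum_filter_not s.powerset Finset.Nonempty
        fun A => binWeight q s.card A.card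
      have h2 : (s.powerset.filter fun A => ¬ A.Nonempty) = {∅} := by
        ext A
        simp only [Finset.mem_filter, Finset.mem_powerset, Finset.not_nonempty_iff_eq_empty,
          Finset.mem_singleton]
        exact ⟨fun h => h.2, fun h => ⟨h ▸ Finset.empty_subset _, h⟩⟩
      rw [h2, Finset.sum_singleton, sum_powerset_binWeight] at h1
      simp only [binWeight, Finset.card_empty, pow_zero, one_mul, Nat.sub_zero] at h1 ⊢
      linarith
    have h3 : q * ∑ A ∈ s.powerset with A.Nonempty, binWeight q s.card (A.card - 1) =
        (1 - q) * (1 - (1 - q) ^ s.card) := by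
      rw [Finset.mul_sum, Finset.sum_congr rfl h, ← Finset.mul_sum, hsum]
    have h4 : ∑ A ∈ s.powerset with A.Nonempty, binWeight q s.card (A.card - 1) =
        (s.card : ℝ) * (1 - q) * (1 / ((s.card : ℝ) * q)) * (1 - (1 - q) ^ s.card) := by
      rcases Nat.eq_zero_or_pos s.card with hs | hs
      · rw [hs] at h3 ⊢
        simp only [pow_zero, sub_self, mul_zero, mul_eq_zero, hq, false_or] at h3 ⊢
        exact h3
      · refine mul_left_cancel₀ hq (h3.trans ?_)
        have : (s.card : ℝ) ≠ 0 := by positivity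
        field_simp
    rw [rateDec, if_neg hq, ← h4, max_eq_left hnn]

theorem sum_binWeight_pred {ι : Type*} [Fintype ι] [DecidableEq ι] {q : ℝ} (h₀ : 0 ≤ q)
    (h₁ : q ≤ 1) :
    ∑ A : Finset ι with A.Nonempty, binWeight q (Fintype.card ι) (A.card - 1) =
      rateDec q (Fintype.card ι) := by
  rw [← Finset.powerset_univ, ← Finset.card_univ]
  exact sum_powerset_binWeight_pred h₀ h₁ Finset.univ

/-- The binomial weight with the empty set left out: the weight of the piece that is cached by
exactly `k` given relays, for `k ≥ 1`. The value `0` at `k = 0` makes the server messages for sets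
of at most one relay disappear. -/
def posWeight (q : ℝ) (n k : ℕ) : ℝ := if k = 0 then 0 else binWeight q n k

theorem posWeight_nonneg {q : ℝ} (h₀ : 0 ≤ q) (h₁ : q ≤ 1) (n k : ℕ) : 0 ≤ posWeight q n k := by
  unfold posWeight
  split_ifs
  · exact le_rfl
  · exact binWeight_nonneg h₀ h₁ n k

theorem sum_posWeight (ι : Type*) [Fintype ι] [DecidableEq ι] (q : ℝ) :
    ∑ A : Finset ι, posWeight q (Fintype.card ι) A.card = 1 - (1 - q) ^ Fintype.card ι := by
  have h : ∀ A : Finset ι, posWeight q (Fintype.card ι) A.card =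
      binWeight q (Fintype.card ι) A.card -
        if A = ∅ then (1 - q) ^ Fintype.card ι else 0 := by
    intro A
    by_cases hA : A = ∅
    · simp [hA, posWeight, binWeight]
    · simp [hA, posWeight]
  rw [Finset.sum_congr rfl fun A _ => h A, Finset.sum_sub_distrib, sum_binWeight]
  simp

theorem sum_posWeight_mem {ι : Type*} [Fintype ι] [DecidableEq ι] (q : ℝ) (i : ι) :
    ∑ A : Finset ι with i ∈ A, posWeight q (Fintype.card ι) A.card = q := by
  refine (Finset.sum_congr rfl fun A hA => if_neg ?_).trans (sum_binWeight_mem q i)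
  exact Finset.card_ne_zero_of_mem (Finset.mem_filter.1 hA).2

/-- The multicast messages to at least two receivers; the messages to single receivers carry the
positions that no receiver caches. -/
theorem sum_posWeight_pred {ι : Type*} [Fintype ι] [DecidableEq ι] {q : ℝ} (h₀ : 0 ≤ q)
    (h₁ : q ≤ 1) :
    ∑ A : Finset ι, posWeight q (Fintype.card ι) (A.card - 1) =
      rateDec q (Fintype.card ι) - Fintype.card ι * (1 - q) ^ Fintype.card ι := by
  have h : ∀ A : Finset ι, posWeight q (Fintype.card ι) (A.card - 1) =
      (if A.Nonempty then binWeight q (Fintype.card ι) (A.card - 1) else 0) -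
        if A.card = 1 then (1 - q) ^ Fintype.card ι else 0 := by
    intro A
    rcases A.eq_empty_or_nonempty with rfl | hA
    · simp [posWeight]
    · have := Finset.card_pos.2 hA
      by_cases h1 : A.card = 1
      · simp [h1, hA, posWeight, binWeight]
      · simp [h1, hA, posWeight, show A.card - 1 ≠ 0 by omega]
  rw [Finset.sum_congr rfl fun A _ => h A, Finset.sum_sub_distrib, ← Finset.sum_filter,
    sum_binWeight_pred h₀ h₁, ← Finset.sum_filter, Finset.sum_const, nsmul_eq_mul]
  have : (Finset.univ.filter fun A : Finset ι => A.card = 1) = Finset.univ.powersetCard 1 := by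
    ext A
    simp
  rw [this, Finset.card_powersetCard, Nat.choose_one_right, Finset.card_univ]

/-- A relay either caches a piece or receives it in a multicast to relays that include it. -/
theorem sum_posWeight_le {ι : Type*} [Fintype ι] [DecidableEq ι] {q : ℝ} (h₀ : 0 ≤ q)
    (h₁ : q ≤ 1) (i : ι) :
    ∑ A : Finset ι, posWeight q (Fintype.card ι) A.card ≤
      q + ∑ A : Finset ι, posWeight q (Fintype.card ι) (A.card - 1) := by
  rw [← Finset.sum_filter_add_sum_filter_not Finset.univ (fun A : Finset ι => i ∈ A),
    sum_posWeight_mem]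
  gcongr 1
  have h : ∑ A : Finset ι with i ∉ A, posWeight q (Fintype.card ι) A.card =
      ∑ A : Finset ι with i ∈ A, posWeight q (Fintype.card ι) (A.card - 1) := by
    refine Finset.sum_nbij' (insert i) (fun A => A.erase i) ?_ ?_ ?_ ?_ ?_
    · simp
    · simp
    · intro A hA
      exact Finset.erase_insert (Finset.mem_filter.1 hA).2
    · intro A hA
      exact Finset.insert_erase (Finset.mem_filter.1 hA).2
    · intro A hA
      rw [Finset.card_insert_of_notMem (Finset.mem_filter.1 hA).2, Nat.add_sub_cancel]
  rw [h]
  exact Finset.sum_le_sum_of_subset_of_nonneg (Finset.filter_subset _ _)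
    fun A _ _ => posWeight_nonneg h₀ h₁ _ _

/-! ### The delay of the scheme -/

theorem cacheFraction_nonneg {m n : ℝ} (hm : 0 ≤ m) (hn : 0 ≤ n) : 0 ≤ cacheFraction m n :=
  le_min (div_nonneg hm hn) zero_le_one

theorem cacheFraction_le_one (m n : ℝ) : cacheFraction m n ≤ 1 := min_le_right _ _

theorem mul_cacheFraction_le {m n : ℝ} (hm : 0 ≤ m) (hn : 0 ≤ n) :
    n * cacheFraction m n ≤ m := by
  rcases hn.eq_or_lt with rfl | hn
  · simpa using hm
  · calc n * cacheFraction m n ≤ n * (m / n) :=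
          mul_le_mul_of_nonneg_left (min_le_left _ _) hn.le
      _ = m := mul_div_cancel₀ m hn.ne'

theorem rateDec_nonneg (q : ℝ) (K : ℕ) : 0 ≤ rateDec q K := by
  unfold rateDec
  split_ifs
  · exact K.cast_nonneg
  · exact le_max_right _ _

/-- The multicast messages to users that are all attached to relays other than `i`. -/
theorem sum_binWeight_pred_other {K₁ K₂ : ℕ} {q : ℝ} (h₀ : 0 ≤ q) (h₁ : q ≤ 1) (i : Fin K₁) :
    ∑ A : Finset (Fin K₁ × Fin K₂) with A.Nonempty ∧ ¬ ∃ j, (i, j) ∈ A,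
      binWeight q (K₁ * K₂) (A.card - 1) = (1 - q) ^ K₂ * rateDec q ((K₁ - 1) * K₂) := by
  set s : Finset (Fin K₁ × Fin K₂) := (Finset.univ.erase i) ×ˢ Finset.univ with hs
  have hcard : s.card = (K₁ - 1) * K₂ := by
    simp [hs, Finset.card_product, Finset.card_erase_of_mem]
  have hK : K₁ * K₂ = s.card + K₂ := by
    obtain ⟨k, rfl⟩ : ∃ k, K₁ = k + 1 := ⟨K₁ - 1, by have := i.pos; omega⟩
    rw [hcard, Nat.add_sub_cancel, Nat.succ_mul]
  have hset : (Finset.univ.filter fun A : Finset (Fin K₁ × Fin K₂) =>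
      A.Nonempty ∧ ¬ ∃ j, (i, j) ∈ A) = s.powerset.filter Finset.Nonempty := by
    ext A
    simp only [Finset.mem_filter, Finset.mem_univ, true_and, Finset.mem_powerset]
    refine ⟨fun h => ⟨fun x hx => ?_, h.1⟩, fun h => ⟨h.2, ?_⟩⟩
    · refine Finset.mem_product.2 ⟨Finset.mem_erase.2 ⟨fun e => h.2 ⟨x.2, ?_⟩,
        Finset.mem_univ _⟩, Finset.mem_univ _⟩
      rw [← e]
      exact hx
    · rintro ⟨j, hj⟩
      exact Finset.notMem_erase _ _ (Finset.mem_product.1 (h.1 hj)).1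
  rw [hset, hK, ← hcard, ← sum_powerset_binWeight_pred h₀ h₁, Finset.mul_sum]
  refine Finset.sum_congr rfl fun A hA => binWeight_add q ?_ _
  have := Finset.card_le_card (Finset.mem_powerset.1 (Finset.mem_filter.1 hA).1)
  omega

theorem theorem1 (N K₁ K₂ : ℕ) (hN : 0 < N) (hK₁ : 0 < K₁) (hK₂ : 0 < K₂)
    (M₁ M₂ : ℝ) (hM₁ : M₁ ∈ Set.Icc (0 : ℝ) (N : ℝ)) (hM₂ : M₂ ∈ Set.Icc (0 : ℝ) (N : ℝ))
    (α β : ℝ) (hα : α ∈ Set.Icc (0 : ℝ) 1) (hβ : β ∈ Set.Icc (0 : ℝ) 1) :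
    optimalDelay N K₁ K₂ M₁ M₂ ≤ ((delayPropose N K₁ K₂ M₁ M₂ α β : ℝ) : EReal) := by
  classical
  obtain ⟨hα0, hα1⟩ := hα
  obtain ⟨hβ0, hβ1⟩ := hβ
  have hN0 : (0 : ℝ) ≤ N := N.cast_nonneg
  have hα' : 0 ≤ 1 - α := sub_nonneg.2 hα1
  have hm2 : 0 ≤ β * M₂ := mul_nonneg hβ0 hM₂.1
  have hm3 : 0 ≤ (1 - β) * M₂ := mul_nonneg (sub_nonneg.2 hβ1) hM₂.1
  simp only [delayPropose, rateConcurrent, ratePipeline, rateS1, rateS2, rateS3, rateE]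
  have ha0 := cacheFraction_nonneg hM₁.1 (mul_nonneg hα0 hN0)
  have ha1 := cacheFraction_le_one M₁ (α * N)
  have haN := mul_cacheFraction_le hM₁.1 (mul_nonneg hα0 hN0)
  have hb0 := cacheFraction_nonneg hm2 (mul_nonneg hα0 hN0)
  have hb1 := cacheFraction_le_one (β * M₂) (α * N)
  have hbN := mul_cacheFraction_le hm2 (mul_nonneg hα0 hN0)
  have hc0 := cacheFraction_nonneg hm3 (mul_nonneg hα' hN0)
  have hc1 := cacheFraction_le_one ((1 - β) * M₂) ((1 - α) * N)
  have hcN := mul_cacheFraction_le hm3 (mul_nonneg hα' hN0)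
  set a := cacheFraction M₁ (α * N)
  set b := cacheFraction (β * M₂) (α * N)
  set c := cacheFraction ((1 - β) * M₂) ((1 - α) * N)
  have hp : 0 ≤ α * (1 - a) ^ K₁ := mul_nonneg hα0 (pow_nonneg (sub_nonneg.2 ha1) _)
  have hcardU : Fintype.card (Fin K₁ × Fin K₂) = K₁ * K₂ := by simp
  have hcard1 : Fintype.card (Fin K₁) = K₁ := by simp
  have hcard2 : Fintype.card (Fin K₂) = K₂ := by simp
  -- Both subsystems place positions that no relay caches, so these pieces are merged.
  set x₀ : ℕ → ℝ := fun k =>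
    α * (1 - a) ^ K₁ * binWeight b (K₁ * K₂) k + (1 - α) * binWeight c (K₁ * K₂) k
  set x₁ : ℕ → ℕ → ℝ := fun s k => α * posWeight a K₁ s * binWeight b K₂ k
  have hx₀_sum : ∀ (s : Finset (Finset (Fin K₁ × Fin K₂))) (f : Finset (Fin K₁ × Fin K₂) → ℕ),
      ∑ A ∈ s, x₀ (f A) = α * (1 - a) ^ K₁ * ∑ A ∈ s, binWeight b (K₁ * K₂) (f A) +
        (1 - α) * ∑ A ∈ s, binWeight c (K₁ * K₂) (f A) := by
    intro s f
    rw [Finset.mul_sum, Finset.mul_sum, ← Finset.sum_add_distrib]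
  have hx₁_sum : ∀ (s : Finset (Finset (Fin K₁))) (t : Finset (Finset (Fin K₂)))
      (f : Finset (Fin K₁) → ℕ) (g : Finset (Fin K₂) → ℕ),
      ∑ S ∈ s, ∑ A ∈ t, x₁ (f S) (g A) =
        α * (∑ S ∈ s, posWeight a K₁ (f S)) * ∑ A ∈ t, binWeight b K₂ (g A) := by
    intro s t f g
    rw [mul_assoc, Finset.sum_mul_sum, Finset.mul_sum]
    refine Finset.sum_congr rfl fun S _ => ?_
    rw [Finset.mul_sum]
    exact Finset.sum_congr rfl fun A _ => mul_assoc _ _ _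
  have hfull : ∀ q : ℝ, ∑ B : Finset (Fin K₁ × Fin K₂), binWeight q (K₁ * K₂) B.card = 1 := by
    intro q
    rw [← hcardU]
    exact sum_binWeight _ q
  have hmem : ∀ (q : ℝ) (v : Fin K₁ × Fin K₂), ∑ B : Finset (Fin K₁ × Fin K₂) with v ∈ B,
      binWeight q (K₁ * K₂) B.card = q := by
    intro q v
    rw [← hcardU]
    exact sum_binWeight_mem q v
  have hpred : ∀ q : ℝ, 0 ≤ q → q ≤ 1 → ∑ A : Finset (Fin K₁ × Fin K₂) with A.Nonempty,
      binWeight q (K₁ * K₂) (A.card - 1) = rateDec q (K₁ * K₂) := by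
    intro q h0 h1
    rw [← hcardU]
    exact sum_binWeight_pred h0 h1
  have hpred2 : ∑ A : Finset (Fin K₂) with A.Nonempty, binWeight b K₂ (A.card - 1) =
      rateDec b K₂ := by
    simpa only [hcard2] using sum_binWeight_pred (ι := Fin K₂) hb0 hb1
  have hfull2 : ∑ A : Finset (Fin K₂), binWeight b K₂ A.card = 1 := by
    simpa only [hcard2] using sum_binWeight (Fin K₂) b
  have hpos : ∑ S : Finset (Fin K₁), posWeight a K₁ S.card = 1 - (1 - a) ^ K₁ := by
    simpa only [hcard1] using sum_posWeight (Fin K₁) a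
  have hposp : ∑ Q : Finset (Fin K₁), posWeight a K₁ (Q.card - 1) =
      rateDec a K₁ - K₁ * (1 - a) ^ K₁ := by
    simpa only [hcard1] using sum_posWeight_pred (ι := Fin K₁) ha0 ha1
  have hr2 := rateDec_nonneg b K₂
  refine optimalDelay_le_of_pieces x₀ x₁
    (fun k => add_nonneg (mul_nonneg hp (binWeight_nonneg hb0 hb1 _ _))
      (mul_nonneg hα' (binWeight_nonneg hc0 hc1 _ _)))
    (fun s k => mul_nonneg (mul_nonneg hα0 (posWeight_nonneg ha0 ha1 _ _))
      (binWeight_nonneg hb0 hb1 _ _)) ?_ ?_ ?_ _ ?_ ?_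
  · rw [hx₀_sum, Fintype.sum_prod_type, hx₁_sum, hfull, hfull, hpos, hfull2]
    ring
  · intro i
    have hset : (Finset.univ.filter fun T : Finset (Fin K₁) × Finset (Fin K₂) => i ∈ T.1) =
        (Finset.univ.filter fun S => i ∈ S) ×ˢ Finset.univ := by
      ext T
      simp
    have hposm : ∑ S : Finset (Fin K₁) with i ∈ S, posWeight a K₁ S.card = a := by
      simpa only [hcard1] using sum_posWeight_mem a i
    rw [hset, Finset.sum_product, hx₁_sum, hposm, hfull2]
    linarith
  · intro i j
    have hset : (Finset.univ.filter fun T : Finset (Fin K₁) × Finset (Fin K₂) => j ∈ T.2) =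
        Finset.univ ×ˢ (Finset.univ.filter fun A => j ∈ A) := by
      ext T
      simp
    have hmem2 : ∑ A : Finset (Fin K₂) with j ∈ A, binWeight b K₂ A.card = b := by
      simpa only [hcard2] using sum_binWeight_mem b j
    rw [hset, Finset.sum_product, hx₁_sum, hx₀_sum, hmem, hmem, hpos, hmem2]
    linarith
  · rw [hx₀_sum, hx₁_sum, hpred b hb0 hb1, hpred c hc0 hc1, hposp, hpred2]
    have := le_max_right (α * a * rateDec b K₂ -
      α * (1 - a) ^ K₁ * (1 - b) ^ K₂ * rateDec b ((K₁ - 1) * K₂)) 0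
    linarith
  · intro i
    -- The relay is idle while the server serves users of other relays only.
    have hidle : α * (1 - a) ^ K₁ * (1 - b) ^ K₂ * rateDec b ((K₁ - 1) * K₂) ≤
        ∑ A : Finset (Fin K₁ × Fin K₂) with A.Nonempty ∧ ¬ ∃ j, (i, j) ∈ A,
          x₀ (A.card - 1) := by
      rw [hx₀_sum, sum_binWeight_pred_other hb0 hb1 i, sum_binWeight_pred_other hc0 hc1 i]
      have := mul_nonneg hα' (mul_nonneg (pow_nonneg (sub_nonneg.2 hc1) K₂)
        (rateDec_nonneg c ((K₁ - 1) * K₂)))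
      linarith
    have hsplit := Finset.sum_filter_add_sum_filter_not
      (Finset.univ.filter fun A : Finset (Fin K₁ × Fin K₂) => A.Nonempty)
      (fun A => ∃ j, (i, j) ∈ A) fun A => x₀ (A.card - 1)
    rw [Finset.filter_filter, Finset.filter_filter] at hsplit
    have hset : (Finset.univ.filter fun A : Finset (Fin K₁ × Fin K₂) =>
        A.Nonempty ∧ ∃ j, (i, j) ∈ A) = Finset.univ.filter fun A => ∃ j, (i, j) ∈ A :=
      Finset.filter_congr fun A _ =>
        ⟨fun h => h.2, fun h => ⟨h.elim fun j hj => ⟨_, hj⟩, h⟩⟩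
    rw [hset, hx₀_sum (Finset.univ.filter fun A => A.Nonempty), hpred b hb0 hb1,
      hpred c hc0 hc1] at hsplit
    rw [hx₁_sum, hpred2]
    have hle : ∑ S : Finset (Fin K₁), posWeight a K₁ S.card ≤
        a + ∑ Q : Finset (Fin K₁), posWeight a K₁ (Q.card - 1) := by
      simpa only [hcard1] using sum_posWeight_le ha0 ha1 i
    rw [hposp] at hle
    have hle' := mul_le_mul_of_nonneg_right (mul_le_mul_of_nonneg_left hle hα0) hr2
    have := le_max_left (α * a * rateDec b K₂ -
      α * (1 - a) ^ K₁ * (1 - b) ^ K₂ * rateDec b ((K₁ - 1) * K₂)) 0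
    linarith
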